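/- Let $\mathcal B$ be a unital $C^*$-algebra, $\mathcal B\langle X\rangle$ the algebraic free product over $\mathbb C$ of $\mathcal B$ and $\mathbb C[X]$, and $\mathcal B_0\langle X\rangle$ the polynomials without constant term. *Partitions.* $NC(n)$ is the set of non-crossing partitions of $\{1,\dots,n\}$, and $\mathrm{Int}(n)\subset NC(n)$ the set of those whose blocks are all intervals. A block $U$ of $\pi$ covers a block $V$, written $U\prec V$, if there are $i,j\in U$ with $i<v<j$ for all $v\in V$; $o(\pi)$ is the number of bijections $f$ from $\pi$ onto $\{1,\dots,|\pi|\}$ such that $U\prec V$ implies $f(U)<f(V)$. For a $\mathcal B$-bimodule map $R:\mathcal B_0\langle X\rangle\to\mathcal B$ and $\pi\in NC(n)$, $R_\pi[b_0Xb_1\cdots Xb_n]$ denotes the nested evaluation: $R_\emptyset[b_0]=b_0$, and if $V=\{p+1,\dots,p+m\}$ is a block of $\pi$ consisting of consecutive elements, then $$R_\pi[b_0X\cdots Xb_n]=R_{\pi\setminus V}\bigl[b_0X\cdots X\,R[b_pXb_{p+1}\cdots Xb_{p+m}]\,Xb_{p+m+1}\cdots Xb_n\bigr].$$ *Cumulants.*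 For a $\mathcal B$-bimodule map $\mu:\mathcal B\langle X\rangle\to\mathcal B$, its free, Boolean and monotone cumulant functionals $R^\mu,B^\mu,K^\mu:\mathcal B_0\langle X\rangle\to\mathcal B$ are the $\mathcal B$-bimodule maps defined implicitly by, for all $n\ge1$, $$\mu[b_0X\cdots Xb_n]=\sum_{\pi\in NC(n)}R^\mu_\pi[b_0X\cdots Xb_n]=\sum_{\pi\in \mathrm{Int}(n)}B^\mu_\pi[b_0X\cdots Xb_n]=\sum_{\pi\in NC(n)}\frac{o(\pi)}{|\pi|!}K^\mu_\pi[b_0X\cdots Xb_n].$$ For $k\in\mathbb N$, the convolution powers $\mu^{\boxplus k},\mu^{\uplus k},\mu^{\rhd k}$ are the $\mathcal B$-bimodule maps that are the identity on $\mathcal B$ and satisfy $R^{\mu^{\boxplus k}}=kR^\mu$, $B^{\mu^{\uplus k}}=kB^\mu$, $K^{\mu^{\rhd k}}=kK^\mu$ respectively. For $\gamma\in\mathcal B$ and a linear map $\sigma:\mathcal B\langle X\rangle\to\mathcal B$ (not necessarily a bimodule map), $\nu_\boxplus^{\gamma,\sigma},\nu_\uplus^{\gamma,\sigma},\nu_\rhd^{\gamma,\sigma}$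 are the $\mathcal B$-bimodule maps that are the identity on $\mathcal B$ and whose free, respectively Boolean, respectively monotone cumulant functional is $$b_0Xb_1\mapsto b_0\gamma b_1,\qquad b_0Xb_1X\cdots b_{n-1}Xb_n\mapsto b_0\,\sigma[b_1X\cdots Xb_{n-1}]\,b_n\quad(n\ge2).$$ *Convergence* $\mu_i\to\mu$ means $\|\mu_i[P]-\mu[P]\|\to0$ for every $P\in\mathcal B\langle X\rangle$. **Theorem.** Let $k_i\in\mathbb N$ with $k_i\to\infty$, let $\gamma\in\mathcal B$, let $\sigma:\mathcal B\langle X\rangle\to\mathcal B$ be linear (in particular, $\gamma$ may be self-adjoint and $\sigma$ completely positive), and let $\mu_i:\mathcal B\langle X\rangle\to\mathcal B$, $i\in\mathbb N$, be linear $\mathcal B$-bimodule maps with bounded moments: for all $i,n$ there is a constant $M_{i,n}$ with $\|\mu_i[b_0Xb_1\cdots Xb_n]\|\le M_{i,n}\|b_0\|\cdots\|b_n\|$ for all $b_0,\dots,b_n\in\mathcal B$. The following are equivalent: (a) $k_i\,\mu_i[X]\to\gamma$, and $k_i\,\mu_i[Xb_1X\cdots b_{n-1}X]\to\sigma[b_1X\cdots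 Xb_{n-1}]$ for all $n\ge2$ and $b_1,\dots,b_{n-1}\in\mathcal B$ (in norm); (b) $\mu_i^{\boxplus k_i}\to\nu_\boxplus^{\gamma,\sigma}$; (c) $\mu_i^{\uplus k_i}\to\nu_\uplus^{\gamma,\sigma}$; (d) $\mu_i^{\rhd k_i}\to\nu_\rhd^{\gamma,\sigma}$. -/

import Mathlib

open Filter Topology

/-! ### The algebra `B⟨X⟩` of non-commutative polynomials -/

/-- The relations that make `some : B → FreeAlgebra ℂ (Option B)` a unital algebra homomorphism;
the generator `none` is the free variable `X`. -/
inductive NCPoly.Rel (B : Type*) [Ring B] [Algebra ℂ B] :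
    FreeAlgebra ℂ (Option B) → FreeAlgebra ℂ (Option B) → Prop
  | add (a b : B) : NCPoly.Rel B (FreeAlgebra.ι ℂ (some (a + b)))
      (FreeAlgebra.ι ℂ (some a) + FreeAlgebra.ι ℂ (some b))
  | mul (a b : B) : NCPoly.Rel B (FreeAlgebra.ι ℂ (some (a * b)))
      (FreeAlgebra.ι ℂ (some a) * FreeAlgebra.ι ℂ (some b))
  | algebraMap (c : ℂ) : NCPoly.Rel B (FreeAlgebra.ι ℂ (some (algebraMap ℂ B c)))
      (algebraMap ℂ (FreeAlgebra ℂ (Option B)) c)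

/-- `B⟨X⟩`, the algebraic free product over `ℂ` of the unital algebra `B` and `ℂ[X]`. -/
abbrev NCPoly (B : Type*) [Ring B] [Algebra ℂ B] : Type _ := RingQuot (NCPoly.Rel B)

namespace NCPoly

variable {B : Type*} [Ring B] [Algebra ℂ B]

/-- The variable `X`. -/
noncomputable def X : NCPoly B := RingQuot.mkAlgHom ℂ (Rel B) (FreeAlgebra.ι ℂ none)

/-- The inclusion `B → B⟨X⟩`. -/
noncomputable def C : B →ₐ[ℂ] NCPoly B :=
  AlgHom.ofLinearMap
    { toFun := fun b => RingQuot.mkAlgHom ℂ (Rel B) (FreeAlgebra.ι ℂ (some b))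
      map_add' := fun a b => by
        rw [RingQuot.mkAlgHom_rel ℂ (Rel.add a b), map_add]
      map_smul' := fun c b => by
        rw [Algebra.smul_def, RingQuot.mkAlgHom_rel ℂ (Rel.mul _ b), map_mul,
          RingQuot.mkAlgHom_rel ℂ (Rel.algebraMap c), AlgHom.commutes, RingHom.id_apply,
          Algebra.smul_def] }
    (by
      have h := RingQuot.mkAlgHom_rel ℂ (Rel.algebraMap (B := B) 1)
      rw [map_one, map_one, map_one] at h
      exact h)
    (fun a b => by
      have h := RingQuot.mkAlgHom_rel ℂ (Rel.mul a b)
      rw [map_mul] at h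
      exact h)

/-- The universal property of the free product. -/
noncomputable def lift {A : Type*} [Semiring A] [Algebra ℂ A] (f : B →ₐ[ℂ] A) (x : A) :
    NCPoly B →ₐ[ℂ] A :=
  RingQuot.liftAlgHom ℂ ⟨FreeAlgebra.lift ℂ (fun o : Option B => o.elim x f), by
    intro p q h
    cases h <;> simp⟩

theorem lift_C {A : Type*} [Semiring A] [Algebra ℂ A] (f : B →ₐ[ℂ] A) (x : A) (b : B) :
    lift f x (C b) = f b := by
  change lift f x (RingQuot.mkAlgHom ℂ (Rel B) (FreeAlgebra.ι ℂ (some b))) = f b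
  simp [lift]

theorem lift_X {A : Type*} [Semiring A] [Algebra ℂ A] (f : B →ₐ[ℂ] A) (x : A) :
    lift f x X = x := by
  simp [lift, X]

/-- `X b_{v₁} X b_{v₂} ⋯ X b_{vₘ}` for `L = [v₁, …, vₘ]`. -/
noncomputable def letters (b : ℕ → B) (L : List ℕ) : NCPoly B :=
  (L.map fun v => X * C (b v)).prod

/-- The monomial `b_s X b_{s+1} X ⋯ X b_{s+n}` with `n` letters `X`. -/
noncomputable def wordFrom (s n : ℕ) (b : ℕ → B) : NCPoly B :=
  C (b s) * letters b (List.range' (s + 1) n)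

/-- The monomial `b_0 X b_1 X ⋯ X b_n` with `n` letters `X`. -/
noncomputable def word (n : ℕ) (b : ℕ → B) : NCPoly B := wordFrom 0 n b

/-- `μ : B⟨X⟩ → B` is a `B`-bimodule map. -/
def IsBimoduleMap (μ : NCPoly B →ₗ[ℂ] B) : Prop :=
  ∀ (a c : B) (P : NCPoly B), μ (C a * P * C c) = a * μ P * c

/-! ### Linear maps on `B⟨X⟩` from families of multilinear maps -/

/-- Families `(φ_n)` where `φ_n` is a `ℂ`-multilinear map of `(b_0, …, b_n)`. -/
abbrev Family (B : Type*) [Ring B] [Algebra ℂ B] : Type _ :=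
  ∀ n : ℕ, MultilinearMap ℂ (fun _ : Fin (n + 1) => B) B

/-- `(φ · b)_n (b_0, …, b_n) = φ_n (b b_0, b_1, …, b_n)`. -/
noncomputable def actC (b : B) : Module.End ℂ (Family B) where
  toFun φ n := ((φ n).curryLeft ∘ₗ LinearMap.mulLeft ℂ b).uncurryLeft
  map_add' φ ψ := by ext n v; simp
  map_smul' c φ := by ext n v; simp

/-- `(φ · X)_n (b_0, …, b_n) = φ_{n+1} (1, b_0, …, b_n)`. -/
noncomputable def actX : Module.End ℂ (Family B) where
  toFun φ n := (φ (n + 1)).curryLeft 1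
  map_add' φ ψ := by ext n v; simp
  map_smul' c φ := by ext n v; simp

theorem actC_apply (b : B) (φ : Family B) (n : ℕ) (v : Fin (n + 1) → B) :
    actC b φ n v = φ n (Fin.cons (b * v 0) (Fin.tail v)) := rfl

theorem actX_apply (φ : Family B) (n : ℕ) (v : Fin (n + 1) → B) :
    actX φ n v = φ (n + 1) (Fin.cons 1 v) := rfl

/-- The right action of `B` on families. -/
noncomputable def actCHom : B →ₐ[ℂ] (Module.End ℂ (Family B))ᵐᵒᵖ :=
  AlgHom.ofLinearMap
    { toFun := fun b => MulOpposite.op (actC b)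
      map_add' := fun a b => by
        rw [← MulOpposite.op_add]
        congr 1
        ext φ n v
        have h : (φ n).curryLeft (a * v 0 + b * v 0) (Fin.tail v) =
            (φ n).curryLeft (a * v 0) (Fin.tail v) + (φ n).curryLeft (b * v 0) (Fin.tail v) := by
          rw [map_add, add_apply]
        rw [← add_mul] at h
        exact h
      map_smul' := fun c b => by
        rw [RingHom.id_apply, ← MulOpposite.op_smul]
        congr 1
        ext φ n v
        have h : (φ n).curryLeft (c • (b * v 0)) (Fin.tail v) =
            c • (φ n).curryLeft (b * v 0) (Fin.tail v) := by
          rw [map_smul, smul_apply]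
        rw [← smul_mul_assoc] at h
        exact h }
    (by
      change MulOpposite.op (actC 1) = 1
      rw [← MulOpposite.op_one]
      congr 1
      ext φ n v
      simp [actC_apply])
    (fun a b => by
      change MulOpposite.op (actC (a * b)) = MulOpposite.op (actC a) * MulOpposite.op (actC b)
      rw [← MulOpposite.op_mul]
      congr 1
      ext φ n v
      simp [actC_apply, mul_assoc])

/-- The right action of `B⟨X⟩` on families. -/
noncomputable def act : NCPoly B →ₐ[ℂ] (Module.End ℂ (Family B))ᵐᵒᵖ :=
  lift actCHom (MulOpposite.op actX)

/-- The linear map `B⟨X⟩ → B` with `b_0 X b_1 X ⋯ X b_n ↦ φ_n (b_0, …, b_n)` for all `n`,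
see `ofFamily_word`. -/
noncomputable def ofFamily (φ : Family B) : NCPoly B →ₗ[ℂ] B where
  toFun P := (act P).unop φ 0 (fun _ => 1)
  map_add' P Q := by simp
  map_smul' c P := by simp

theorem act_mul (P Q : NCPoly B) (φ : Family B) :
    (act (P * Q)).unop φ = (act Q).unop ((act P).unop φ) := by
  simp

theorem act_C (b : B) (φ : Family B) : (act (C b)).unop φ = actC b φ := by
  rw [act, lift_C]; rfl

theorem act_X (φ : Family B) : (act X).unop φ = actX φ := by
  rw [act, lift_X]; rfl

theorem ofFamily_wordFrom (n : ℕ) : ∀ (s : ℕ) (b : ℕ → B) (φ : Family B),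
    ofFamily φ (wordFrom s n b) = φ n (fun i => b (s + i)) := by
  induction n with
  | zero =>
    intro s b φ
    change (act (C (b s) * letters b [])).unop φ 0 (fun _ => 1) = _
    rw [letters, List.map_nil, List.prod_nil, mul_one, act_C, actC_apply]
    congr 1
    funext i
    refine Fin.cases ?_ (fun j => j.elim0) i
    simp
  | succ n ih =>
    intro s b φ
    have h : wordFrom s (n + 1) b = C (b s) * X * wordFrom (s + 1) n b := by
      simp [wordFrom, letters, List.range'_succ, mul_assoc]
    have h2 := ih (s + 1) b ((act (C (b s) * X)).unop φ)
    change (act (wordFrom s (n + 1) b)).unop φ 0 (fun _ => 1) = _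
    rw [h, act_mul]
    refine h2.trans ?_
    rw [act_mul, act_C, act_X, actX_apply, actC_apply]
    congr 1
    funext i
    refine Fin.cases ?_ (fun j => ?_) i
    · simp
    · simp only [Fin.cons_succ, Fin.tail, Fin.val_succ]
      congr 1
      ring

theorem ofFamily_word (n : ℕ) (b : ℕ → B) (φ : Family B) :
    ofFamily φ (word n b) = φ n (fun i => b i) := by
  rw [word, ofFamily_wordFrom]
  simp

/-! ### Multilinear dependence on sequences of coefficients -/

/-- `f` is `ℂ`-linear in the entry `b j` of the sequence `b`. -/
def LinearAt {A : Type*} [AddCommGroup A] [Module ℂ A] (f : (ℕ → B) → A) (j : ℕ) : Prop :=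
  (∀ (b : ℕ → B) (x y : B), f (Function.update b j (x + y)) =
    f (Function.update b j x) + f (Function.update b j y)) ∧
  ∀ (b : ℕ → B) (c : ℂ) (x : B), f (Function.update b j (c • x)) =
    c • f (Function.update b j x)

/-- `(b_0, …, b_n)` as a sequence, continued by zero. -/
def extend {n : ℕ} (v : Fin (n + 1) → B) : ℕ → B :=
  fun j => if h : j < n + 1 then v ⟨j, h⟩ else 0

theorem extend_update {n : ℕ} (v : Fin (n + 1) → B) (i : Fin (n + 1)) (x : B) :
    extend (Function.update v i x) = Function.update (extend v) (i : ℕ) x := by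
  funext j
  by_cases h : j = i
  · subst h
    have h' : (i : ℕ) < n + 1 := i.2
    simp only [extend, h', dif_pos, Fin.eta, Function.update_self]
  · by_cases hj : j < n + 1
    · have h' : (⟨j, hj⟩ : Fin (n + 1)) ≠ i := fun e => h (congrArg Fin.val e)
      simp [extend, h, hj, h']
    · have h' : ¬ j < n + 1 := hj
      rw [Function.update_of_ne h]
      simp only [extend, h', dif_neg, not_false_eq_true]

/-- The multilinear map `(b_0, …, b_n) ↦ f b`. -/
def toMultilinear (n : ℕ) (f : (ℕ → B) → B) (hf : ∀ j ≤ n, LinearAt f j) :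
    MultilinearMap ℂ (fun _ : Fin (n + 1) => B) B where
  toFun v := f (extend v)
  map_update_add' {inst} v i x y := by
    rw [Subsingleton.elim inst (instDecidableEqFin (n + 1))]
    simp only [extend_update]
    exact (hf i (Nat.lt_succ_iff.mp i.2)).1 _ x y
  map_update_smul' {inst} v i c x := by
    rw [Subsingleton.elim inst (instDecidableEqFin (n + 1))]
    simp only [extend_update]
    exact (hf i (Nat.lt_succ_iff.mp i.2)).2 _ c x

theorem letters_congr {b b' : ℕ → B} {L : List ℕ} (h : ∀ j ∈ L, b j = b' j) :
    letters b L = letters b' L := by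
  unfold letters
  congr 1
  exact List.map_congr_left fun j hj => by rw [h j hj]

theorem letters_update {L : List ℕ} {j : ℕ} (hj : j ∉ L) (b : ℕ → B) (x : B) :
    letters (Function.update b j x) L = letters b L :=
  letters_congr fun _ hi => Function.update_of_ne (ne_of_mem_of_not_mem hi hj) _ _

theorem linearAt_letters {L : List ℕ} (hL : L.Nodup) {j : ℕ} (hj : j ∈ L) :
    LinearAt (fun b : ℕ → B => letters b L) j := by
  induction L with
  | nil => simp at hj
  | cons a L ih =>
    have hc : ∀ b : ℕ → B, letters b (a :: L) = X * C (b a) * letters b L := fun b => by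
      simp [letters]
    rw [List.nodup_cons] at hL
    by_cases h : j = a
    · subst h
      constructor
      · intro b x y
        simp [hc, letters_update hL.1, mul_add, add_mul]
      · intro b c x
        simp [hc, letters_update hL.1]
    · have hj' : j ∈ L := by simpa [h] using hj
      have h' : a ≠ j := fun e => h e.symm
      constructor
      · intro b x y
        simp only [hc, (ih hL.2 hj').1 b x y, Function.update_of_ne h', mul_add]
      · intro b c x
        simp only [hc, (ih hL.2 hj').2 b c x, Function.update_of_ne h', mul_smul_comm]

theorem linearAt_C_mul_letters {L : List ℕ} (hL : L.Nodup) {p j : ℕ} (hp : p ∉ L)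
    (hj : j = p ∨ j ∈ L) (R : NCPoly B →ₗ[ℂ] B) :
    LinearAt (fun b : ℕ → B => R (C (b p) * letters b L)) j := by
  rcases hj with rfl | hj
  · constructor
    · intro b x y
      simp [letters_update hp, add_mul]
    · intro b c x
      simp [letters_update hp]
  · have h' : p ≠ j := fun e => hp (e ▸ hj)
    constructor
    · intro b x y
      simp only [(linearAt_letters hL hj).1 b x y, Function.update_of_ne h', mul_add, map_add]
    · intro b c x
      simp only [(linearAt_letters hL hj).2 b c x, Function.update_of_ne h', mul_smul_comm,
        map_smul]

theorem linearAt_wordFrom (R : NCPoly B →ₗ[ℂ] B) (s n j : ℕ) (h1 : s ≤ j) (h2 : j ≤ s + n) :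
    LinearAt (fun b : ℕ → B => R (wordFrom s n b)) j := by
  refine linearAt_C_mul_letters List.nodup_range' ?_ ?_ R
  · simp [List.mem_range'_1]
  · simp only [List.mem_range'_1]
    omega

/-! ### Non-crossing partitions and nested evaluation -/

/-- `π` is non-crossing: there are no `i < j < k < l` with `i, k` in one block and `j, l` in
another. -/
def IsNonCrossing {n : ℕ} (π : Finpartition (Finset.Icc 1 n)) : Prop :=
  ∀ U ∈ π.parts, ∀ V ∈ π.parts, U ≠ V →
    ¬ ∃ i ∈ U, ∃ j ∈ V, ∃ k ∈ U, ∃ l ∈ V, i < j ∧ j < k ∧ k < l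

/-- `π` is an interval partition: every block is an interval. -/
def IsIntervalPartition {n : ℕ} (π : Finpartition (Finset.Icc 1 n)) : Prop :=
  ∀ V ∈ π.parts, ∀ i ∈ V, ∀ k ∈ V, ∀ j, i < j → j < k → j ∈ V

/-- `U ≺ V`: the block `U` covers the block `V`. -/
def Covers (U V : Finset ℕ) : Prop := ∃ i ∈ U, ∃ j ∈ U, ∀ v ∈ V, i < v ∧ v < j

/-- `o(π)`, the number of order-preserving bijections from `(π, ≺)` onto a chain with `|π|`
elements. -/
noncomputable def numOrders {n : ℕ} (π : Finpartition (Finset.Icc 1 n)) : ℕ :=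
  Nat.card {f : π.parts ≃ Fin π.parts.card //
    ∀ U V : π.parts, Covers (U : Finset ℕ) (V : Finset ℕ) → f U < f V}

/-- The block with the smallest maximum. In a non-crossing partition it consists of consecutive
elements of the underlying set. -/
noncomputable def firstClosed (P : Finset (Finset ℕ)) (h : P.Nonempty) : Finset ℕ :=
  (P.exists_min_image (fun V => V.sup id) h).choose

/-- The largest element of `{0} ∪ ⋃ P` to the left of `V`. -/
noncomputable def leftNeighbour (P : Finset (Finset ℕ)) (V : Finset ℕ) : ℕ :=
  ((insert 0 (P.sup id)).filter fun p => ∀ v ∈ V, p < v).sup id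

/-- Auxiliary recursion for `nest`, on the number of blocks. -/
noncomputable def nestAux (R : NCPoly B →ₗ[ℂ] B) : ℕ → Finset (Finset ℕ) → (ℕ → B) → B
  | 0, _, b => b 0
  | k + 1, P, b =>
    open Classical in
    if h : P.Nonempty then
      let V := firstClosed P h
      let p := leftNeighbour P V
      nestAux R k (P.erase V)
        (Function.update b p (R (C (b p) * letters b (V.sort (· ≤ ·)))))
    else b 0

/-- The nested evaluation `R_π[b_0 X b_1 X ⋯ X b_n]` of a bimodule map `R` along the set `P` of
blocks of a non-crossing partition: `R_∅[b_0] = b_0`, and if `V = {v_1 < ⋯ < v_m}` is a block whose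
elements are consecutive among the letters that are present, with `p` the letter just before
`v_1` (`p = 0` if there is none), then
`⋯ X_p b_p X_{v_1} b_{v_1} ⋯ X_{v_m} b_{v_m} ⋯` is replaced by
`⋯ X_p R[b_p X b_{v_1} ⋯ X b_{v_m}] ⋯` and `V` is removed from the partition. -/
noncomputable def nest (R : NCPoly B →ₗ[ℂ] B) (P : Finset (Finset ℕ)) (b : ℕ → B) : B :=
  nestAux R P.card P b

theorem firstClosed_mem (P : Finset (Finset ℕ)) (h : P.Nonempty) : firstClosed P h ∈ P :=
  (P.exists_min_image (fun V => V.sup id) h).choose_spec.1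

theorem leftNeighbour_spec (P : Finset (Finset ℕ)) {V : Finset ℕ} (h0 : 0 ∉ V) :
    (leftNeighbour P V = 0 ∨ leftNeighbour P V ∈ P.sup id) ∧
      ∀ v ∈ V, leftNeighbour P V < v := by
  have hne : ((insert 0 (P.sup id)).filter fun p => ∀ v ∈ V, p < v).Nonempty :=
    ⟨0, by
      simp only [Finset.mem_filter, Finset.mem_insert, true_or, true_and]
      intro v hv
      exact Nat.pos_of_ne_zero fun e => h0 (e ▸ hv)⟩
  obtain ⟨x, hx, hxe⟩ := Finset.exists_mem_eq_sup _ hne (id : ℕ → ℕ)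
  have hm : leftNeighbour P V = x := hxe
  rw [hm]
  simpa only [Finset.mem_filter, Finset.mem_insert] using hx

theorem nestAux_congr (R : NCPoly B →ₗ[ℂ] B) (k : ℕ) : ∀ (P : Finset (Finset ℕ)) (b b' : ℕ → B),
    (∀ V ∈ P, 0 ∉ V) → (∀ j, j = 0 ∨ j ∈ P.sup id → b j = b' j) →
    nestAux R k P b = nestAux R k P b' := by
  induction k with
  | zero =>
    intro P b b' _ h
    exact h 0 (Or.inl rfl)
  | succ k ih =>
    intro P b b' h0 h
    unfold nestAux
    by_cases hP : P.Nonempty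
    · simp only [hP, dif_pos]
      have hV := firstClosed_mem P hP
      have hp := leftNeighbour_spec P (h0 _ hV)
      have hl : letters b ((firstClosed P hP).sort (· ≤ ·)) =
          letters b' ((firstClosed P hP).sort (· ≤ ·)) := letters_congr fun j hj => by
        refine h j (Or.inr ?_)
        rw [Finset.mem_sup]
        exact ⟨_, hV, (Finset.mem_sort _).mp hj⟩
      rw [hl, h _ hp.1]
      refine ih _ _ _ (fun V hV' => h0 V (Finset.mem_of_mem_erase hV')) fun j hj => ?_
      by_cases hjp : j = leftNeighbour P (firstClosed P hP)
      · subst hjp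
        simp
      · rw [Function.update_of_ne hjp, Function.update_of_ne hjp]
        refine h j (hj.imp_right fun hj' => ?_)
        rw [Finset.mem_sup] at hj' ⊢
        obtain ⟨U, hU, hjU⟩ := hj'
        exact ⟨U, Finset.mem_of_mem_erase hU, hjU⟩
    · simp only [hP, dif_neg, not_false_eq_true]
      exact h 0 (Or.inl rfl)

theorem linearAt_nestAux (R : NCPoly B →ₗ[ℂ] B) (k : ℕ) : ∀ (P : Finset (Finset ℕ)), P.card = k →
    (∀ V ∈ P, 0 ∉ V) → (P : Set (Finset ℕ)).PairwiseDisjoint id →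
    ∀ j, j = 0 ∨ j ∈ P.sup id → LinearAt (nestAux R k P) j := by
  induction k with
  | zero =>
    intro P hP _ _ j hj
    rw [Finset.card_eq_zero] at hP
    subst hP
    have hj0 : j = 0 := by simpa using hj
    subst hj0
    constructor <;> intros <;> simp [nestAux]
  | succ k ih =>
    intro P hc h0 hd j hj
    have hP : P.Nonempty := Finset.card_pos.mp (by omega)
    have hV := firstClosed_mem P hP
    have hp := leftNeighbour_spec P (h0 _ hV)
    set V := firstClosed P hP with hVdef
    set p := leftNeighbour P V with hpdef
    have hstep : ∀ b : ℕ → B, nestAux R (k + 1) P b = nestAux R k (P.erase V)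
        (Function.update b p (R (C (b p) * letters b (V.sort (· ≤ ·))))) := fun b => by
      rw [nestAux, dif_pos hP]
    have hpV : p ∉ V := fun hm => lt_irrefl _ (hp.2 p hm)
    have hsub : ∀ i, i ∈ (P.erase V).sup id → i ∈ P.sup id ∧ i ∉ V := by
      intro i hi
      rw [Finset.mem_sup] at hi
      obtain ⟨U, hU, hiU⟩ := hi
      refine ⟨Finset.mem_sup.mpr ⟨U, Finset.mem_of_mem_erase hU, hiU⟩, fun hiV => ?_⟩
      exact Finset.disjoint_left.mp
        (hd (Finset.mem_of_mem_erase hU) hV (Finset.ne_of_mem_erase hU)) hiU hiV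
    have hrest : ∀ i, i = 0 ∨ i ∈ P.sup id → i ∉ V → i = 0 ∨ i ∈ (P.erase V).sup id := by
      intro i hi hiV
      refine hi.imp_right fun hi' => ?_
      rw [Finset.mem_sup] at hi' ⊢
      obtain ⟨U, hU, hiU⟩ := hi'
      exact ⟨U, Finset.mem_erase.mpr ⟨fun e => hiV (e ▸ hiU), hU⟩, hiU⟩
    have h0' : ∀ U ∈ P.erase V, 0 ∉ U := fun U hU => h0 U (Finset.mem_of_mem_erase hU)
    have hcard : (P.erase V).card = k := by
      rw [Finset.card_erase_of_mem hV]
      omega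
    have IH := ih (P.erase V) hcard h0'
      (hd.subset (by exact_mod_cast Finset.erase_subset V P))
    have hpl : LinearAt (nestAux R k (P.erase V)) p := IH p (hrest p hp.1 hpV)
    have hnd : (V.sort (· ≤ ·)).Nodup := Finset.sort_nodup V _
    have hpL : p ∉ V.sort (· ≤ ·) := by rwa [Finset.mem_sort]
    by_cases hin : j = p ∨ j ∈ V
    · have hl := linearAt_C_mul_letters hnd hpL
        (hin.imp_right fun h => (Finset.mem_sort (· ≤ ·)).mpr h) R
      have hdrop : ∀ (b : ℕ → B) (x y : B),
          nestAux R k (P.erase V) (Function.update (Function.update b j x) p y) =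
            nestAux R k (P.erase V) (Function.update b p y) := by
        intro b x y
        refine nestAux_congr R k _ _ _ h0' fun i hi => ?_
        by_cases hip : i = p
        · subst hip
          simp
        · rw [Function.update_of_ne hip, Function.update_of_ne hip]
          refine Function.update_of_ne (fun e => ?_) _ _
          rcases hin with h | h
          · exact hip (e.trans h)
          · rcases hi with hi | hi
            · exact h0 V hV (hi ▸ e ▸ h)
            · exact (hsub i hi).2 (e ▸ h)
      constructor
      · intro b x y
        have := hl.1 b x y
        simp only at this
        simp only [hstep, hdrop]
        rw [this, hpl.1]
      · intro b c x
        have := hl.2 b c x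
        simp only at this
        simp only [hstep, hdrop]
        rw [this, hpl.2]
    · rw [not_or] at hin
      have hjr := IH j (hrest j hj hin.2)
      have hjL : j ∉ V.sort (· ≤ ·) := by
        rw [Finset.mem_sort]
        exact hin.2
      have hpj : p ≠ j := fun e => hin.1 e.symm
      constructor
      · intro b x y
        simp only [hstep, letters_update hjL, Function.update_of_ne hpj]
        simp only [Function.update_comm (Ne.symm hpj)]
        exact hjr.1 _ x y
      · intro b c x
        simp only [hstep, letters_update hjL, Function.update_of_ne hpj]
        simp only [Function.update_comm (Ne.symm hpj)]
        exact hjr.2 _ c x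

theorem linearAt_nest (R : NCPoly B →ₗ[ℂ] B) {n : ℕ} (π : Finpartition (Finset.Icc 1 n))
    (j : ℕ) (hj : j ≤ n) : LinearAt (nest R π.parts) j := by
  refine linearAt_nestAux R _ π.parts rfl (fun V hV h => ?_) π.disjoint j ?_
  · have := π.le hV h
    simp at this
  · rw [π.sup_parts, Finset.mem_Icc]
    omega

/-- `R_π` as a multilinear map of `(b_0, …, b_n)`. -/
noncomputable def nestMultilinear (R : NCPoly B →ₗ[ℂ] B) {n : ℕ}
    (π : Finpartition (Finset.Icc 1 n)) : MultilinearMap ℂ (fun _ : Fin (n + 1) => B) B :=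
  toMultilinear n (nest R π.parts) (linearAt_nest R π)

/-! ### Cumulants and convolution powers -/

/-- Weights of partitions of `{1, …, n}`. -/
abbrev Weight : Type := ∀ n : ℕ, Finpartition (Finset.Icc 1 n) → ℂ

open Classical in
/-- Free probability: weight `1` on `NC(n)`. -/
noncomputable def freeWeight : Weight := fun _ π => if IsNonCrossing π then 1 else 0

open Classical in
/-- Boolean probability: weight `1` on interval partitions. -/
noncomputable def booleanWeight : Weight := fun _ π => if IsIntervalPartition π then 1 else 0

open Classical in
/-- Monotone probability: weight `o(π)/|π|!` on `NC(n)`. -/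
noncomputable def monotoneWeight : Weight := fun _ π =>
  if IsNonCrossing π then (numOrders π : ℂ) / (Nat.factorial π.parts.card : ℂ) else 0

/-- The linear map `B⟨X⟩ → B` with cumulant functional `R`:
`b_0 X b_1 ⋯ X b_n ↦ ∑_π w(π) R_π[b_0 X b_1 ⋯ X b_n]` (in particular `b_0 ↦ b_0` for `n = 0`, for
each of the three weights above). -/
noncomputable def ofCumulants (w : Weight) (R : NCPoly B →ₗ[ℂ] B) : NCPoly B →ₗ[ℂ] B :=
  ofFamily fun n => ∑ π : Finpartition (Finset.Icc 1 n), w n π • nestMultilinear R π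

/-- The cumulants of `μ`, by recursion on the degree: `μ[b_0 X ⋯ X b_n]` minus the terms of
the moment-cumulant formula with at least two blocks, which only involve lower cumulants. -/
noncomputable def cumulantFamily (w : Weight) (μ : NCPoly B →ₗ[ℂ] B) : Family B
  | 0 => 0
  | n + 1 =>
    toMultilinear (n + 1) (fun b => μ (word (n + 1) b))
        (fun j hj => linearAt_wordFrom μ 0 (n + 1) j (Nat.zero_le j) (by omega)) -
      ∑ π : Finpartition (Finset.Icc 1 (n + 1)) with 2 ≤ π.parts.card,
        w (n + 1) π • nestMultilinear
          (ofFamily fun m => if _h : m < n + 1 then cumulantFamily w μ m else 0) π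

/-- The cumulant functional of `μ` for the weight `w`, the solution of
`μ[b_0 X ⋯ X b_n] = ∑_π w(π) R_π[b_0 X ⋯ X b_n]`, `n ≥ 1`. It lives on the polynomials without
constant term and is continued by `0` to the constants. -/
noncomputable def cumulant (w : Weight) (μ : NCPoly B →ₗ[ℂ] B) : NCPoly B →ₗ[ℂ] B :=
  ofFamily (cumulantFamily w μ)

theorem word_congr (n : ℕ) {b b' : ℕ → B} (h : ∀ j ≤ n, b j = b' j) : word n b = word n b' := by
  unfold word wordFrom
  rw [h 0 (Nat.zero_le n), letters_congr]
  intro j hj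
  rw [List.mem_range'_1] at hj
  exact h j (by omega)

theorem extend_apply {n : ℕ} (b : ℕ → B) {j : ℕ} (hj : j ≤ n) :
    extend (fun i : Fin (n + 1) => b i) j = b j := by
  have h : j < n + 1 := by omega
  simp only [extend, h, dif_pos]

theorem nest_singleton (R : NCPoly B →ₗ[ℂ] B) (n : ℕ) (hn : 1 ≤ n) (b : ℕ → B) :
    nest R {Finset.Icc 1 n} b = R (word n b) := by
  have hs : ({Finset.Icc 1 n} : Finset (Finset ℕ)).Nonempty := ⟨_, Finset.mem_singleton_self _⟩
  have h1 : firstClosed _ hs = Finset.Icc 1 n := Finset.mem_singleton.mp (firstClosed_mem _ hs)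
  have h0 : (0 : ℕ) ∉ Finset.Icc 1 n := by simp
  have hp : leftNeighbour {Finset.Icc 1 n} (Finset.Icc 1 n) = 0 := by
    have := (leftNeighbour_spec {Finset.Icc 1 n} h0).2 1 (by simp [hn])
    omega
  have hl : (Finset.Icc 1 n).sort (· ≤ ·) = List.range' 1 n := by
    refine List.Perm.eq_of_pairwise (le := (· ≤ ·)) ?_ (Finset.pairwise_sort _ _) ?_ ?_
    · intro a b _ _ h h'; exact le_antisymm h h'
    · exact List.pairwise_le_range' (s := 1) (n := n)
    · refine (List.perm_ext_iff_of_nodup (Finset.sort_nodup _ _) List.nodup_range').mpr ?_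
      intro a
      rw [Finset.mem_sort, Finset.mem_Icc, List.mem_range'_1]
      omega
  rw [nest, Finset.card_singleton, nestAux, dif_pos hs]
  simp only [h1, hp, hl]
  simp [nestAux, word, wordFrom]

/-- `nest R P` depends on `R` only through its values on words with as many letters as some block
of `P`. -/
theorem nestAux_R {R R' : NCPoly B →ₗ[ℂ] B} (k : ℕ) : ∀ (P : Finset (Finset ℕ)) (b : ℕ → B),
    (∀ V ∈ P, ∀ (p : ℕ) (b : ℕ → B), R (C (b p) * letters b (V.sort (· ≤ ·))) =
      R' (C (b p) * letters b (V.sort (· ≤ ·)))) → nestAux R k P b = nestAux R' k P b := by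
  induction k with
  | zero => intros; rfl
  | succ k ih =>
    intro P b h
    unfold nestAux
    by_cases hP : P.Nonempty
    · simp only [hP, dif_pos]
      rw [h _ (firstClosed_mem P hP)]
      exact ih _ _ fun V hV => h V (Finset.mem_of_mem_erase hV)
    · simp [hP]

theorem exists_word (L : List ℕ) (p : ℕ) (b : ℕ → B) :
    ∃ b' : ℕ → B, C (b p) * letters b L = word L.length b' := by
  have key : ∀ (L : List ℕ) (p s : ℕ), ∃ b' : ℕ → B, C (b p) * letters b L = wordFrom s L.length b' := by
    intro L
    induction L with
    | nil => intro p s; exact ⟨fun _ => b p, by simp [letters, wordFrom]⟩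
    | cons a L ih =>
      intro p s
      obtain ⟨b', hb'⟩ := ih a (s+1)
      refine ⟨Function.update b' s (b p), ?_⟩
      have : wordFrom s (L.length+1) (Function.update b' s (b p)) = C (b p) * X * wordFrom (s + 1) L.length b' := by
        simp only [wordFrom, letters, List.range'_succ, List.map_cons, List.prod_cons, Function.update_self]
        rw [Function.update_of_ne (by omega)]
        have h2 := letters_update (B := B) (L := List.range' (s+1+1) L.length) (j := s) (by simp [List.mem_range'_1]) b' (b p)
        unfold letters at h2
        rw [h2]
        simp [mul_assoc]
      rw [List.length_cons, this, ← hb']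
      simp [letters, mul_assoc]
  exact key L p 0

theorem cumulant_word_short (w : Weight) (μ : NCPoly B →ₗ[ℂ] B) (n m : ℕ) (hm : m < n) (b : ℕ → B) :
    ofFamily (fun m => if _h : m < n then cumulantFamily w μ m else 0) (word m b) =
      cumulant w μ (word m b) := by
  rw [ofFamily_word, cumulant, ofFamily_word]
  simp [hm]

/-- The moment-cumulant formula, for any weight that is `1` on the one-block partition. -/
theorem moment_cumulant (w : Weight) (μ : NCPoly B →ₗ[ℂ] B) (n : ℕ)
    (hw : ∀ π : Finpartition (Finset.Icc 1 (n+1)), π.parts.card = 1 → w (n + 1) π = 1)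
    (b : ℕ → B) :
    μ (word (n + 1) b) = ofCumulants w (cumulant w μ) (word (n + 1) b) := by
  have hbe : ∀ j ≤ n+1, extend (fun i : Fin (n + 1 + 1) => b i) j = b j := fun j hj => extend_apply b hj
  have hne : Finset.Icc 1 (n+1) ≠ ⊥ := by
    rw [Finset.bot_eq_empty]; exact (Finset.nonempty_Icc.mpr (by omega)).ne_empty
  have hone : ∀ π : Finpartition (Finset.Icc 1 (n+1)), π.parts.card = 1 → π = Finpartition.indiscrete hne := by
    intro π hπ
    obtain ⟨V, hV⟩ := Finset.card_eq_one.mp hπ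
    ext1
    have := π.sup_parts
    rw [hV] at this ⊢
    simp at this
    simp [Finpartition.indiscrete, this]
  have hpos : ∀ π : Finpartition (Finset.Icc 1 (n+1)), 1 ≤ π.parts.card := fun π =>
    Finset.card_pos.mpr (π.parts_nonempty hne)
  have hfil : (Finset.univ.filter fun π : Finpartition (Finset.Icc 1 (n + 1)) => ¬ 2 ≤ π.parts.card) = {Finpartition.indiscrete hne} := by
    ext π
    simp only [Finset.mem_filter, Finset.mem_univ, true_and, Finset.mem_singleton]
    constructor
    · intro h; exact hone π (by have := hpos π; omega)
    · rintro rfl; simp [Finpartition.indiscrete]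
  rw [ofCumulants, ofFamily_word, ← Finset.sum_filter_add_sum_filter_not Finset.univ (fun π : Finpartition (Finset.Icc 1 (n + 1)) => 2 ≤ π.parts.card), hfil, Finset.sum_singleton]
  rw [hw _ (by simp [Finpartition.indiscrete]), one_smul, add_apply]
  have h1 : nestMultilinear (cumulant w μ) (Finpartition.indiscrete hne) (fun i : Fin (n+1+1) => b i) = cumulantFamily w μ (n+1) (fun i => b i) := by
    change nest (cumulant w μ) {Finset.Icc 1 (n+1)} _ = _
    rw [nest_singleton _ _ (by omega), word_congr _ hbe, cumulant, ofFamily_word]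
  have h2 : ∀ π : Finpartition (Finset.Icc 1 (n+1)), 2 ≤ π.parts.card → nestMultilinear (cumulant w μ) π = nestMultilinear (ofFamily fun m => if _h : m < n + 1 then cumulantFamily w μ m else 0) π := by
    intro π hπ
    ext v
    refine nestAux_R _ _ _ fun V hV p b => ?_
    obtain ⟨b', hb'⟩ := exists_word (V.sort (· ≤ ·)) p b
    rw [hb', cumulant_word_short]
    rw [Finset.length_sort]
    have hss : V ⊂ Finset.Icc 1 (n+1) := by
      refine (Finset.ssubset_iff_subset_ne).mpr ⟨π.le hV, fun e => ?_⟩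
      obtain ⟨U, hU, hUV⟩ := Finset.exists_mem_ne (by omega : 1 < π.parts.card) V
      have hd := π.disjoint hU hV hUV
      have hUs := π.le hU
      rw [← e] at hUs
      exact π.ne_bot hU (Disjoint.eq_bot_of_le hd hUs)
    simpa using Finset.card_lt_card hss
  rw [h1, cumulantFamily, sub_apply]
  rw [Finset.sum_congr rfl fun π hπ => by rw [h2 π (Finset.mem_filter.mp hπ).2]]
  change _ = _ + (μ (word (n+1) (extend _)) - _)
  rw [word_congr _ hbe]
  abel

/-- The `k`-th convolution power of `μ`: its cumulant functional is `k` times that of `μ`. -/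
noncomputable def convPow (w : Weight) (k : ℕ) (μ : NCPoly B →ₗ[ℂ] B) : NCPoly B →ₗ[ℂ] B :=
  ofCumulants w ((k : ℂ) • cumulant w μ)

/-- `μ^{⊞ k}`. -/
noncomputable def freePow (k : ℕ) (μ : NCPoly B →ₗ[ℂ] B) : NCPoly B →ₗ[ℂ] B :=
  convPow freeWeight k μ

/-- `μ^{⊎ k}`. -/
noncomputable def booleanPow (k : ℕ) (μ : NCPoly B →ₗ[ℂ] B) : NCPoly B →ₗ[ℂ] B :=
  convPow booleanWeight k μ

/-- `μ^{▷ k}`. -/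
noncomputable def monotonePow (k : ℕ) (μ : NCPoly B →ₗ[ℂ] B) : NCPoly B →ₗ[ℂ] B :=
  convPow monotoneWeight k μ

/-! ### The limit distributions -/

theorem linearAt_levy_one (γ : B) (j : ℕ) (hj : j ≤ 1) :
    LinearAt (fun b : ℕ → B => b 0 * γ * b 1) j := by
  have : j = 0 ∨ j = 1 := by omega
  rcases this with rfl | rfl <;> constructor <;> intros <;> simp [add_mul, mul_add]

theorem linearAt_levy (σ : NCPoly B →ₗ[ℂ] B) (n j : ℕ) (hj : j ≤ n + 2) :
    LinearAt (fun b : ℕ → B => b 0 * σ (wordFrom 1 n b) * b (n + 2)) j := by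
  have hout : ∀ i, i = 0 ∨ i = n + 2 → ∀ (b : ℕ → B) (x : B),
      wordFrom 1 n (Function.update b i x) = wordFrom 1 n b := by
    intro i hi b x
    have h1 : (1 : ℕ) ≠ i := by omega
    have h2 : i ∉ List.range' (1 + 1) n := by
      rw [List.mem_range'_1]
      omega
    rw [wordFrom, letters_update h2, Function.update_of_ne h1, wordFrom]
  have : j = 0 ∨ j = n + 2 ∨ (1 ≤ j ∧ j ≤ 1 + n) := by omega
  rcases this with rfl | rfl | ⟨h1, h2⟩
  · constructor <;> intros <;> simp [hout, add_mul]
  · constructor <;> intros <;> simp [hout, mul_add]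
  · have hl := linearAt_wordFrom σ 1 n j h1 h2
    have h3 : (0 : ℕ) ≠ j := by omega
    have h4 : n + 2 ≠ j := by omega
    constructor
    · intro b x y
      have := hl.1 b x y
      simp only [Function.update_of_ne h3, Function.update_of_ne h4, this, mul_add, add_mul]
    · intro b c x
      have := hl.2 b c x
      simp only [Function.update_of_ne h3, Function.update_of_ne h4, this, mul_smul_comm,
        smul_mul_assoc]

/-- The functional `b_0 X b_1 ↦ b_0 γ b_1`,
`b_0 X b_1 X ⋯ b_{n-1} X b_n ↦ b_0 σ[b_1 X ⋯ X b_{n-1}] b_n` for `n ≥ 2`, continued by `0` to the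
constants. -/
noncomputable def levyCumulant (γ : B) (σ : NCPoly B →ₗ[ℂ] B) : NCPoly B →ₗ[ℂ] B :=
  ofFamily fun
    | 0 => 0
    | 1 => toMultilinear 1 (fun b => b 0 * γ * b 1) (linearAt_levy_one γ)
    | n + 2 => toMultilinear (n + 2) (fun b => b 0 * σ (wordFrom 1 n b) * b (n + 2))
        (linearAt_levy σ n)

/-- `ν_⊞^{γ,σ}`. -/
noncomputable def freeLimit (γ : B) (σ : NCPoly B →ₗ[ℂ] B) : NCPoly B →ₗ[ℂ] B :=
  ofCumulants freeWeight (levyCumulant γ σ)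

/-- `ν_⊎^{γ,σ}`. -/
noncomputable def booleanLimit (γ : B) (σ : NCPoly B →ₗ[ℂ] B) : NCPoly B →ₗ[ℂ] B :=
  ofCumulants booleanWeight (levyCumulant γ σ)

/-- `ν_▷^{γ,σ}`. -/
noncomputable def monotoneLimit (γ : B) (σ : NCPoly B →ₗ[ℂ] B) : NCPoly B →ₗ[ℂ] B :=
  ofCumulants monotoneWeight (levyCumulant γ σ)

end NCPoly

/-! ### Boundedness and convergence -/

/-- For each `n` the `n`-th moment map `(b_0, …, b_n) ↦ μ[b_0 X b_1 ⋯ X b_n]` is a bounded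
multilinear map. -/
def NCPoly.HasBoundedMoments {B : Type*} [CStarAlgebra B] (μ : NCPoly B →ₗ[ℂ] B) : Prop :=
  ∀ n : ℕ, ∃ M : ℝ, ∀ b : ℕ → B,
    ‖μ (NCPoly.word n b)‖ ≤ M * ∏ j ∈ Finset.range (n + 1), ‖b j‖

/-- `μ_i → ν`: convergence in norm of `μ_i[P]` to `ν[P]` for every polynomial `P`. -/
def NCPoly.ConvergesTo {B : Type*} [CStarAlgebra B] (μ : ℕ → NCPoly B →ₗ[ℂ] B)
    (ν : NCPoly B →ₗ[ℂ] B) : Prop :=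
  ∀ P : NCPoly B, Tendsto (fun i => μ i P) atTop (𝓝 (ν P))

namespace NCPoly

/-! ### Monomials: reindexing, peeling off letters, spanning -/

section Algebraic

variable {B : Type*} [Ring B] [Algebra ℂ B]

/-! The three equivalences are one argument, in which the partition weight `w` matters only through
its value `1` on partitions with at most one block (`Weight.Normalized`). For such a weight, a
moment of degree `n + 1` is the cumulant of degree `n + 1` plus a finite sum over partitions with at
least two blocks, whose blocks all have size at most `n`. The passage between moments and cumulants
is therefore triangular in the degree.

This is used twice, each time by strong induction on the degree. First, `convPow w k μ` has
cumulants `k • cumulant w μ`, and convergence of moments to `ofCumulants w L` is equivalent to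
convergence of cumulants to `L` (`convergesTo_ofCumulants_iff`). Second, nested evaluation along `π`
is homogeneous of degree `|π|` in the functional, so `k R_π = k^(1-|π|) (kR)_π`; if `kR` converges
in lower degrees, this vanishes for `|π| ≥ 2` as `k → ∞`. So `k μ` and `k • cumulant w μ` have the
same limits on words (`tendsto_moments_iff`). The weight has then disappeared: each of (b), (c), (d)
says that `k μ` converges to `levyCumulant γ σ` on words of positive length, and by the bimodule
property this is (a).

The analytic difficulty is that a nested evaluation inserts one value of `R i` as a coefficient of
another, so the coefficients move with `i`. Pointwise convergence must be upgraded to convergence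
along convergent coefficients (`StrongTendsto`). The uniform boundedness principle for multilinear
maps does this, and it is where bounded moments enter. No continuity of `σ` is needed. -/

/-- An explicit reindexing, not just an existence statement: the new coefficients are coordinates of
`b`, so they converge whenever `b` does. The default `0` of `getD` sits beyond the end of the word
and is never read. -/
theorem C_mul_letters (b : ℕ → B) (p : ℕ) (L : List ℕ) :
    C (b p) * letters b L = word L.length (fun j => b ((p :: L).getD j 0)) := by
  have key : ∀ (L : List ℕ) (s : ℕ) (d : ℕ → ℕ), (∀ j, d (s + j) = L.getD j 0) →
      letters b L = letters (fun j => b (d j)) (List.range' s L.length) := by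
    intro L
    induction L with
    | nil => intro s d _; simp [letters]
    | cons a L ih =>
      intro s d hd
      have h0 := hd 0
      have h1 := ih (s + 1) d fun j => by
        have := hd (j + 1)
        rw [show s + 1 + j = s + (j + 1) by ring, this]
        simp
      simp only [letters, List.length_cons, List.range'_succ, List.map_cons,
        List.prod_cons] at h1 ⊢
      rw [h1]
      simp at h0
      rw [h0]
  rw [word, wordFrom, key L (0 + 1) (fun j => (p :: L).getD j 0) fun j => by
    rw [zero_add, add_comm]; simp]
  simp

theorem C_mul_word (a : B) (n : ℕ) (b : ℕ → B) :
    C a * word n b = word n (Function.update b 0 (a * b 0)) := by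
  rw [word, word, wordFrom, wordFrom, letters_update (by simp [List.mem_range'_1]),
    Function.update_self, map_mul, mul_assoc]

theorem wordFrom_succ (s n : ℕ) (b : ℕ → B) :
    wordFrom s (n + 1) b = C (b s) * X * wordFrom (s + 1) n b := by
  simp [wordFrom, letters, List.range'_succ, mul_assoc]

theorem wordFrom_succ_right (n : ℕ) : ∀ (s : ℕ) (b : ℕ → B),
    wordFrom s (n + 1) b = wordFrom s n b * X * C (b (s + n + 1)) := by
  induction n with
  | zero => intro s b; simp [wordFrom, letters, List.range'_succ, mul_assoc]
  | succ n ih =>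
    intro s b
    rw [wordFrom_succ, ih, wordFrom_succ, show s + 1 + n + 1 = s + (n + 1) + 1 by ring]
    simp only [mul_assoc]

theorem wordFrom_eq_word (n : ℕ) : ∀ (s : ℕ) (b : ℕ → B),
    wordFrom s n b = word n fun j => b (s + j) := by
  have key : ∀ (n s t : ℕ) (b : ℕ → B), wordFrom (s + t) n b = wordFrom t n fun j => b (s + j) := by
    intro n
    induction n with
    | zero => intro s t b; simp [wordFrom, letters]
    | succ n ih =>
      intro s t b
      rw [wordFrom_succ, wordFrom_succ, add_assoc, ih]
  intro s b
  exact key n s 0 b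

theorem X_mul_word (n : ℕ) (b : ℕ → B) :
    X * word n b = word (n + 1) (fun j => Nat.casesOn j 1 b) := by
  rw [word, word, wordFrom_succ, wordFrom_eq_word n (0 + 1), wordFrom_eq_word n 0]
  simp [add_comm 1]

theorem induction_on {p : NCPoly B → Prop} (P : NCPoly B) (hC : ∀ b, p (C b)) (hX : p X)
    (hadd : ∀ P Q, p P → p Q → p (P + Q)) (hmul : ∀ P Q, p P → p Q → p (P * Q)) : p P := by
  obtain ⟨P, rfl⟩ := RingQuot.mkAlgHom_surjective ℂ (Rel B) P
  induction P using FreeAlgebra.induction with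
  | grade0 c =>
    have := hC (algebraMap ℂ B c)
    rwa [AlgHom.commutes] at this ⊢
  | grade1 o =>
    cases o with
    | none => exact hX
    | some b => exact hC b
  | mul P Q hP hQ => rw [map_mul]; exact hmul _ _ hP hQ
  | add P Q hP hQ => rw [map_add]; exact hadd _ _ hP hQ

/-- The span of the words is stable under left multiplication by constants and by `X`, hence is a
left ideal, and it contains `1`. -/
theorem span_word :
    Submodule.span ℂ {P : NCPoly B | ∃ (n : ℕ) (b : ℕ → B), P = word n b} = ⊤ := by
  set S := Submodule.span ℂ {P : NCPoly B | ∃ (n : ℕ) (b : ℕ → B), P = word n b} with hS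
  have hgen : ∀ Q : NCPoly B, (∀ (n : ℕ) (b : ℕ → B), Q * word n b ∈ S) →
      ∀ T ∈ S, Q * T ∈ S := by
    intro Q hQ T hT
    induction hT using Submodule.span_induction with
    | mem T hT => obtain ⟨n, b, rfl⟩ := hT; exact hQ n b
    | zero => simp
    | add T U _ _ hT hU => rw [mul_add]; exact S.add_mem hT hU
    | smul c T _ hT => rw [mul_smul_comm]; exact S.smul_mem c hT
  have hmul : ∀ Q : NCPoly B, ∀ T ∈ S, Q * T ∈ S := by
    intro Q
    induction Q using induction_on with
    | hC b =>
      exact hgen _ fun n c => Submodule.subset_span ⟨n, _, C_mul_word b n c⟩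
    | hX => exact hgen _ fun n c => Submodule.subset_span ⟨n + 1, _, X_mul_word n c⟩
    | hadd P Q hP hQ => intro T hT; rw [add_mul]; exact S.add_mem (hP T hT) (hQ T hT)
    | hmul P Q hP hQ => intro T hT; rw [mul_assoc]; exact hP _ (hQ T hT)
  rw [eq_top_iff]
  intro P _
  have h1 : (1 : NCPoly B) ∈ S := Submodule.subset_span ⟨0, fun _ => 1, by
    simp [word, wordFrom, letters]⟩
  simpa using hmul P 1 h1

/-! ### Nested evaluations -/

theorem nestAux_succ (R : NCPoly B →ₗ[ℂ] B) (k : ℕ) {P : Finset (Finset ℕ)} (h : P.Nonempty)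
    (b : ℕ → B) : nestAux R (k + 1) P b = nestAux R k (P.erase (firstClosed P h))
      (Function.update b (leftNeighbour P (firstClosed P h))
        (R (C (b (leftNeighbour P (firstClosed P h))) *
          letters b ((firstClosed P h).sort (· ≤ ·))))) := by
  rw [nestAux, dif_pos h]

/-- Each block removed contributes one factor `c`. It is created in the slot of the left neighbour
and pulled out by linearity of the remaining evaluation in that slot. -/
theorem nestAux_smul (c : ℂ) (R : NCPoly B →ₗ[ℂ] B) (k : ℕ) : ∀ (P : Finset (Finset ℕ)),
    P.card = k → (∀ V ∈ P, 0 ∉ V) → (P : Set (Finset ℕ)).PairwiseDisjoint id →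
    ∀ b, nestAux (c • R) k P b = c ^ k • nestAux R k P b := by
  induction k with
  | zero => intros; simp [nestAux]
  | succ k ih =>
    intro P hc h0 hd b
    have hP : P.Nonempty := Finset.card_pos.mp (by omega)
    have hV := firstClosed_mem P hP
    have hp := leftNeighbour_spec P (h0 _ hV)
    have hcard : (P.erase (firstClosed P hP)).card = k := by
      rw [Finset.card_erase_of_mem hV]
      omega
    have h0' : ∀ U ∈ P.erase (firstClosed P hP), 0 ∉ U :=
      fun U hU => h0 U (Finset.mem_of_mem_erase hU)
    have hd' : ((P.erase (firstClosed P hP) : Finset (Finset ℕ)) :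
        Set (Finset ℕ)).PairwiseDisjoint id :=
      hd.subset (by exact_mod_cast Finset.erase_subset _ P)
    have hlin : LinearAt (nestAux R k (P.erase (firstClosed P hP)))
        (leftNeighbour P (firstClosed P hP)) := by
      -- The left neighbour lies strictly to the left of the removed block, so its slot survives the
      -- removal.
      refine linearAt_nestAux R k _ hcard h0' hd' _ (hp.1.imp_right fun h => ?_)
      rw [Finset.mem_sup] at h ⊢
      obtain ⟨U, hU, hpU⟩ := h
      exact ⟨U, Finset.mem_erase.mpr
        ⟨fun e => lt_irrefl _ (hp.2 _ (e ▸ hpU)), hU⟩, hpU⟩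
    rw [nestAux_succ _ _ hP, nestAux_succ _ _ hP, ih _ hcard h0' hd', LinearMap.smul_apply,
      hlin.2, smul_smul, pow_succ]

theorem nest_smul (c : ℂ) (R : NCPoly B →ₗ[ℂ] B) {n : ℕ} (π : Finpartition (Finset.Icc 1 n))
    (b : ℕ → B) : nest (c • R) π.parts b = c ^ π.parts.card • nest R π.parts b := by
  refine nestAux_smul c R _ π.parts rfl (fun V hV h => ?_) π.disjoint b
  simpa using π.le hV h

theorem nest_congr (R : NCPoly B →ₗ[ℂ] B) {n : ℕ} (π : Finpartition (Finset.Icc 1 n))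
    {b b' : ℕ → B} (h : ∀ j ≤ n, b j = b' j) : nest R π.parts b = nest R π.parts b' := by
  refine nestAux_congr R _ π.parts b b' (fun V hV h => ?_) fun j hj => h j ?_
  · simpa using π.le hV h
  · rw [π.sup_parts, Finset.mem_Icc] at hj
    omega

/-! ### The moment-cumulant formula, split by number of blocks -/

/-- This makes the formula triangular: terms with at least two blocks see only cumulants of strictly
smaller, positive degree. -/
theorem card_mem_parts {n : ℕ} {π : Finpartition (Finset.Icc 1 (n + 1))}
    (hπ : 2 ≤ π.parts.card) {V : Finset ℕ} (hV : V ∈ π.parts) : ∃ m < n, V.card = m + 1 := by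
  have hss : V ⊂ Finset.Icc 1 (n + 1) := by
    refine (Finset.ssubset_iff_subset_ne).mpr ⟨π.le hV, fun e => ?_⟩
    obtain ⟨U, hU, hUV⟩ := Finset.exists_mem_ne (by omega : 1 < π.parts.card) V
    have hUs := π.le hU
    rw [← e] at hUs
    exact π.ne_bot hU (Disjoint.eq_bot_of_le (π.disjoint hU hV hUV) hUs)
  have h1 : V.card < n + 1 := by simpa using Finset.card_lt_card hss
  have h2 : 0 < V.card := Finset.card_pos.mpr (Finset.nonempty_iff_ne_empty.mpr (π.ne_bot hV))
  exact ⟨V.card - 1, by omega, by omega⟩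

/-- The weight is `1` on all partitions with at most one block. -/
def Weight.Normalized (w : Weight) : Prop :=
  ∀ (n : ℕ) (π : Finpartition (Finset.Icc 1 n)), π.parts.card ≤ 1 → w n π = 1

/-- The terms with at least two blocks of the moment-cumulant formula. -/
noncomputable def higherTerms (w : Weight) (R : NCPoly B →ₗ[ℂ] B) (n : ℕ) (b : ℕ → B) : B :=
  ∑ π : Finpartition (Finset.Icc 1 n) with 2 ≤ π.parts.card, w n π • nest R π.parts b

theorem ofCumulants_word (w : Weight) (R : NCPoly B →ₗ[ℂ] B) (n : ℕ) (b : ℕ → B) :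
    ofCumulants w R (word n b) =
      ∑ π : Finpartition (Finset.Icc 1 n), w n π • nest R π.parts b := by
  rw [ofCumulants, ofFamily_word, sum_apply]
  refine Finset.sum_congr rfl fun π _ => ?_
  rw [smul_apply]
  congr 1
  exact nest_congr R π fun j hj => extend_apply b hj

theorem ofCumulants_word_zero {w : Weight} (hw : w.Normalized) (R : NCPoly B →ₗ[ℂ] B)
    (b : ℕ → B) : ofCumulants w R (word 0 b) = b 0 := by
  have hp : ∀ π : Finpartition (Finset.Icc 1 0), π.parts = ∅ := by
    intro π
    rw [Finset.eq_empty_iff_forall_notMem]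
    intro V hV
    exact π.ne_bot hV (le_bot_iff.mp (π.le hV))
  have hs : ∀ π ρ : Finpartition (Finset.Icc 1 0), π = ρ := fun π ρ => by
    ext1
    rw [hp, hp]
  rw [ofCumulants_word, Finset.sum_eq_single ⊥
    (fun π _ h => (h (hs _ _)).elim) (fun h => (h (Finset.mem_univ _)).elim)]
  -- Degree zero is the reason for `≤ 1` rather than `= 1` in `Weight.Normalized`: the only
  -- partition of the empty set has no blocks.
  rw [hw 0 _ (by rw [hp]; simp), hp, one_smul]
  simp [nest, nestAux]

theorem ofCumulants_word_succ {w : Weight} (hw : w.Normalized) (R : NCPoly B →ₗ[ℂ] B) (n : ℕ)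
    (b : ℕ → B) :
    ofCumulants w R (word (n + 1) b) = R (word (n + 1) b) + higherTerms w R (n + 1) b := by
  have hne : Finset.Icc 1 (n + 1) ≠ ⊥ := by
    rw [Finset.bot_eq_empty]
    exact (Finset.nonempty_Icc.mpr (by omega)).ne_empty
  have hfil : (Finset.univ.filter fun π : Finpartition (Finset.Icc 1 (n + 1)) =>
      ¬ 2 ≤ π.parts.card) = {Finpartition.indiscrete hne} := by
    ext π
    simp only [Finset.mem_filter, Finset.mem_univ, true_and, Finset.mem_singleton]
    constructor
    · intro h
      have h1 : 0 < π.parts.card := Finset.card_pos.mpr (π.parts_nonempty hne)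
      obtain ⟨V, hV⟩ := Finset.card_eq_one.mp (by omega : π.parts.card = 1)
      ext1
      have := π.sup_parts
      rw [hV] at this ⊢
      simp at this
      simp [Finpartition.indiscrete, this]
    · rintro rfl
      simp [Finpartition.indiscrete]
  rw [ofCumulants_word, ← Finset.sum_filter_add_sum_filter_not Finset.univ
    (fun π : Finpartition (Finset.Icc 1 (n + 1)) => 2 ≤ π.parts.card), hfil,
    Finset.sum_singleton, hw _ _ (by simp [Finpartition.indiscrete]), one_smul, add_comm]
  congr 1
  exact nest_singleton R (n + 1) (by omega) b

theorem word_eq_cumulant_add {w : Weight} (hw : w.Normalized) (μ : NCPoly B →ₗ[ℂ] B) (n : ℕ)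
    (b : ℕ → B) : μ (word (n + 1) b) =
      cumulant w μ (word (n + 1) b) + higherTerms w (cumulant w μ) (n + 1) b := by
  rw [moment_cumulant w μ n (fun π hπ => hw _ π hπ.le) b, ofCumulants_word_succ hw]

/-! ### The three weights -/

theorem eq_of_card_parts_le_one {n : ℕ} {π : Finpartition (Finset.Icc 1 n)}
    (h : π.parts.card ≤ 1) {U V : Finset ℕ} (hU : U ∈ π.parts) (hV : V ∈ π.parts) : U = V :=
  Finset.card_le_one.mp h U hU V hV

theorem isNonCrossing_of_card_le_one {n : ℕ} {π : Finpartition (Finset.Icc 1 n)}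
    (h : π.parts.card ≤ 1) : IsNonCrossing π :=
  fun _ hU _ hV hne => (hne (eq_of_card_parts_le_one h hU hV)).elim

theorem normalized_freeWeight : freeWeight.Normalized := fun _ _ h =>
  if_pos (isNonCrossing_of_card_le_one h)

theorem normalized_booleanWeight : booleanWeight.Normalized := fun n π h => by
  refine if_pos fun V hV i hi k hk j hij hjk => ?_
  have hj : j ∈ Finset.Icc 1 n := by
    have h1 := Finset.mem_Icc.mp (π.le hV hi)
    have h2 := Finset.mem_Icc.mp (π.le hV hk)
    exact Finset.mem_Icc.mpr (by omega)
  rw [← π.sup_parts, Finset.mem_sup] at hj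
  obtain ⟨U, hU, hjU⟩ := hj
  exact eq_of_card_parts_le_one h hU hV ▸ hjU

/-- A block never covers itself, so with at most one block the order condition is vacuous and all
`|π|!` bijections are counted. -/
theorem normalized_monotoneWeight : monotoneWeight.Normalized := fun n π h => by
  have ho : numOrders π = Nat.factorial π.parts.card := by
    have hall : ∀ f : π.parts ≃ Fin π.parts.card,
        ∀ U V : π.parts, Covers (U : Finset ℕ) (V : Finset ℕ) → f U < f V := by
      rintro f U V ⟨i, hi, j, hj, hc⟩
      rw [eq_of_card_parts_le_one h U.2 V.2] at hi
      exact (lt_irrefl _ (hc i hi).1).elim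
    rw [numOrders, Nat.card_congr (Equiv.subtypeUnivEquiv hall), Nat.card_eq_fintype_card,
      Fintype.card_equiv π.parts.equivFin]
    simp
  rw [monotoneWeight, if_pos (isNonCrossing_of_card_le_one h), ho]
  exact div_self (by exact_mod_cast Nat.factorial_ne_zero _)

/-! ### The limit cumulants -/

theorem levyCumulant_word_one (γ : B) (σ : NCPoly B →ₗ[ℂ] B) (b : ℕ → B) :
    levyCumulant γ σ (word 1 b) = b 0 * γ * b 1 := by
  rw [levyCumulant, ofFamily_word]
  change extend (fun i : Fin 2 => b i) 0 * γ * extend (fun i : Fin 2 => b i) 1 = _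
  rw [extend_apply b (by omega), extend_apply b (by omega)]

theorem levyCumulant_word_add_two (γ : B) (σ : NCPoly B →ₗ[ℂ] B) (n : ℕ) (b : ℕ → B) :
    levyCumulant γ σ (word (n + 2) b) = b 0 * σ (word n fun j => b (1 + j)) * b (n + 2) := by
  rw [levyCumulant, ofFamily_word]
  change extend (fun i : Fin (n + 2 + 1) => b i) 0 *
    σ (wordFrom 1 n (extend (fun i : Fin (n + 2 + 1) => b i))) *
      extend (fun i : Fin (n + 2 + 1) => b i) (n + 2) = _
  rw [extend_apply b (by omega), extend_apply b (by omega), wordFrom_eq_word]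
  congr 3
  exact word_congr n fun j hj => extend_apply b (by omega)

theorem IsBimoduleMap.word_one {μ : NCPoly B →ₗ[ℂ] B} (hμ : IsBimoduleMap μ) (b : ℕ → B) :
    μ (word 1 b) = b 0 * μ X * b 1 := by
  rw [← hμ]
  simp [word, wordFrom, letters, mul_assoc]

theorem IsBimoduleMap.word_add_two {μ : NCPoly B →ₗ[ℂ] B} (hμ : IsBimoduleMap μ) (n : ℕ)
    (b : ℕ → B) :
    μ (word (n + 2) b) = b 0 * μ (X * word n (fun j => b (1 + j)) * X) * b (n + 2) := by
  rw [← hμ, word, wordFrom_succ_right, wordFrom_succ, wordFrom_eq_word n]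
  simp [mul_assoc]

end Algebraic

/-! ### Convergence on words -/

section Analytic

variable {B : Type*} [CStarAlgebra B]

/-- Convergence of `R i` to `L` on words of length `n` with convergent coefficients. -/
def StrongTendsto (n : ℕ) (R : ℕ → NCPoly B →ₗ[ℂ] B) (L : NCPoly B →ₗ[ℂ] B) : Prop :=
  ∀ (b : ℕ → ℕ → B) (c : ℕ → B), Tendsto b atTop (𝓝 c) →
    Tendsto (fun i => R i (word n (b i))) atTop (𝓝 (L (word n c)))

theorem StrongTendsto.tendsto {n : ℕ} {R : ℕ → NCPoly B →ₗ[ℂ] B} {L : NCPoly B →ₗ[ℂ] B}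
    (h : StrongTendsto n R L) (b : ℕ → B) :
    Tendsto (fun i => R i (word n b)) atTop (𝓝 (L (word n b))) :=
  h _ b tendsto_const_nhds

/-- Lets the limit lemmas for sequences of functionals double as continuity lemmas for a single one.
-/
theorem strongTendsto_const_iff {n : ℕ} {R : NCPoly B →ₗ[ℂ] B} :
    StrongTendsto n (fun _ => R) R ↔ Continuous fun b => R (word n b) := by
  refine ⟨fun h => SeqContinuous.continuous fun b c hb => h b c hb, fun h b c hb => ?_⟩
  exact (h.tendsto c).comp hb

/-! ### Boundedness and the upgrade to strong convergence -/

/-- The values on words of length `n` as a multilinear map. -/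
noncomputable def wordMultilinear (R : NCPoly B →ₗ[ℂ] B) (n : ℕ) :
    MultilinearMap ℂ (fun _ : Fin (n + 1) => B) B :=
  toMultilinear n (fun b => R (word n b)) fun j hj =>
    linearAt_wordFrom R 0 n j (Nat.zero_le j) (by omega)

theorem wordMultilinear_apply (R : NCPoly B →ₗ[ℂ] B) (n : ℕ) (b : ℕ → B) :
    wordMultilinear R n (fun i => b i) = R (word n b) :=
  congrArg R (word_congr n fun _ hj => extend_apply b hj)

theorem continuous_extend (n : ℕ) :
    Continuous (extend : (Fin (n + 1) → B) → ℕ → B) := by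
  refine continuous_pi fun j => ?_
  by_cases h : j < n + 1
  · simp only [extend, h, dif_pos]
    fun_prop
  · simp only [extend, h, dif_neg, not_false_eq_true]
    fun_prop

theorem HasBoundedMoments.continuous_word {μ : NCPoly B →ₗ[ℂ] B} (h : HasBoundedMoments μ)
    (n : ℕ) : Continuous fun b => μ (word n b) := by
  obtain ⟨M, hM⟩ := h n
  have hb : ∀ v, ‖wordMultilinear μ n v‖ ≤ M * ∏ i, ‖v i‖ := fun v => by
    refine (hM (extend v)).trans_eq ?_
    rw [← Fin.prod_univ_eq_prod_range (fun j => ‖extend v j‖) (n + 1)]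
    congr 2
    funext i
    simp only [extend, i.2, dif_pos, Fin.eta]
  have hc := ((wordMultilinear μ n).mkContinuous M hb).cont
  have := hc.comp (f := fun b : ℕ → B => fun i : Fin (n + 1) => b i) (by fun_prop)
  refine this.congr fun b => wordMultilinear_apply μ n b

/-- The uniform boundedness principle for multilinear maps. -/
theorem exists_norm_le_of_pointwise_bounded {E F : Type*} [NormedAddCommGroup E]
    [NormedSpace ℂ E] [CompleteSpace E] [NormedAddCommGroup F] [NormedSpace ℂ F] {ι : Type*}
    (n : ℕ) : ∀ f : ι → ContinuousMultilinearMap ℂ (fun _ : Fin n => E) F,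
    (∀ v, ∃ M, ∀ i, ‖f i v‖ ≤ M) → ∃ M, ∀ i, ‖f i‖ ≤ M := by
  induction n with
  | zero =>
    intro f h
    obtain ⟨M, hM⟩ := h 0
    refine ⟨max M 0, fun i => ContinuousMultilinearMap.opNorm_le_bound (le_max_right _ _) fun v => ?_⟩
    rw [Subsingleton.elim v 0]
    simpa using Or.inl (hM i)
  | succ n ih =>
    intro f h
    -- With the first variable frozen, the induction hypothesis bounds the curried maps;
    -- Banach–Steinhaus then applies in the first variable. Currying is isometric.
    have := banach_steinhaus (g := fun i => (f i).curryLeft) fun x =>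
      ih (fun i => (f i).curryLeft x) fun v => h (Fin.cons x v)
    simpa using this

/-- Pointwise convergence bounds the orbits, hence the norms of the multilinear maps uniformly in
`i`. This equicontinuity absorbs the change from `b i` to `c`, and pointwise convergence at `c` does
the rest. Continuity is required of each `R i` only, not of `L`. -/
theorem strongTendsto_of_tendsto {n : ℕ} {R : ℕ → NCPoly B →ₗ[ℂ] B} {L : NCPoly B →ₗ[ℂ] B}
    (hc : ∀ i, Continuous fun b => R i (word n b))
    (h : ∀ b, Tendsto (fun i => R i (word n b)) atTop (𝓝 (L (word n b)))) :
    StrongTendsto n R L := by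
  let f : ℕ → ContinuousMultilinearMap ℂ (fun _ : Fin (n + 1) => B) B := fun i =>
    ⟨wordMultilinear (R i) n, (hc i).comp (continuous_extend n)⟩
  have hf : ∀ i (b : ℕ → B), f i (fun j => b j) = R i (word n b) := fun i b =>
    wordMultilinear_apply (R i) n b
  obtain ⟨M, hM⟩ := exists_norm_le_of_pointwise_bounded (n + 1) f fun v => by
    obtain ⟨M, hM⟩ := ((h (extend v)).norm).bddAbove_range
    exact ⟨M, fun i => hM ⟨i, rfl⟩⟩
  intro b c hb
  have hr : Tendsto (fun i => fun j : Fin (n + 1) => b i j) atTop (𝓝 fun j => c j) :=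
    tendsto_pi_nhds.mpr fun j => tendsto_pi_nhds.mp hb j
  have hdiff : Tendsto (fun i => R i (word n (b i)) - R i (word n c)) atTop (𝓝 0) := by
    -- The telescoping bound for a multilinear map `f` in `N` variables: `‖f x - f y‖ ≤ ‖f‖ N
    -- max(‖x‖, ‖y‖)^(N-1) ‖x - y‖`.
    refine squeeze_zero_norm (a := fun i => M * (Fintype.card (Fin (n + 1)) : ℝ) *
      max ‖fun j : Fin (n + 1) => b i j‖ ‖fun j : Fin (n + 1) => c j‖ ^
        (Fintype.card (Fin (n + 1)) - 1) *
      ‖(fun j : Fin (n + 1) => b i j) - fun j : Fin (n + 1) => c j‖) (fun i => ?_) ?_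
    · rw [← hf, ← hf]
      refine ((f i).norm_image_sub_le _ _).trans ?_
      gcongr
      exact hM i
    · have h0 := (tendsto_sub_nhds_zero_iff.mpr hr).norm
      have h1 := (((hr.norm.max (tendsto_const_nhds
        (x := ‖fun j : Fin (n + 1) => c j‖))).pow
          (Fintype.card (Fin (n + 1)) - 1)).const_mul
            (M * (Fintype.card (Fin (n + 1)) : ℝ))).mul h0
      simpa using h1
  simpa using hdiff.add (h c)

/-! ### Limits of nested evaluations -/

/-- Removing a block replaces one coefficient by a value of `R i`, which converges by hypothesis.
The updated coefficient sequence still converges, so the recursion continues. -/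
theorem tendsto_nestAux {R : ℕ → NCPoly B →ₗ[ℂ] B} {L : NCPoly B →ₗ[ℂ] B} (k : ℕ) :
    ∀ (P : Finset (Finset ℕ)), (∀ V ∈ P, StrongTendsto V.card R L) →
    ∀ (b : ℕ → ℕ → B) (c : ℕ → B), Tendsto b atTop (𝓝 c) →
    Tendsto (fun i => nestAux (R i) k P (b i)) atTop (𝓝 (nestAux L k P c)) := by
  induction k with
  | zero =>
    intro P _ b c hb
    exact tendsto_pi_nhds.mp hb 0
  | succ k ih =>
    intro P h b c hb
    by_cases hP : P.Nonempty
    · simp only [nestAux_succ _ _ hP]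
      refine ih _ (fun V hV => h V (Finset.mem_of_mem_erase hV)) _ _ (hb.update _ ?_)
      simp only [C_mul_letters, Finset.length_sort]
      exact h _ (firstClosed_mem P hP) _ _
        (tendsto_pi_nhds.mpr fun j => tendsto_pi_nhds.mp hb _)
    · simp only [nestAux, hP, dif_neg, not_false_eq_true]
      exact tendsto_pi_nhds.mp hb 0

theorem tendsto_nest {R : ℕ → NCPoly B →ₗ[ℂ] B} {L : NCPoly B →ₗ[ℂ] B} {n : ℕ}
    (h : ∀ m < n, StrongTendsto (m + 1) R L) {π : Finpartition (Finset.Icc 1 (n + 1))}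
    (hπ : 2 ≤ π.parts.card) {b : ℕ → ℕ → B} {c : ℕ → B} (hb : Tendsto b atTop (𝓝 c)) :
    Tendsto (fun i => nest (R i) π.parts (b i)) atTop (𝓝 (nest L π.parts c)) := by
  refine tendsto_nestAux _ _ (fun V hV => ?_) b c hb
  obtain ⟨m, hm, hVm⟩ := card_mem_parts hπ hV
  exact hVm ▸ h m hm

theorem tendsto_higherTerms (w : Weight) {R : ℕ → NCPoly B →ₗ[ℂ] B} {L : NCPoly B →ₗ[ℂ] B}
    {n : ℕ} (h : ∀ m < n, StrongTendsto (m + 1) R L) {b : ℕ → ℕ → B} {c : ℕ → B}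
    (hb : Tendsto b atTop (𝓝 c)) :
    Tendsto (fun i => higherTerms w (R i) (n + 1) (b i)) atTop
      (𝓝 (higherTerms w L (n + 1) c)) :=
  tendsto_finsetSum _ fun _ hπ =>
    (tendsto_nest h (Finset.mem_filter.mp hπ).2 hb).const_smul _

/-- By strong induction: the cumulant is a continuous moment minus nested evaluations of lower
cumulants, which are continuous by the constant-sequence case of `tendsto_higherTerms`. -/
theorem continuous_cumulant {w : Weight} (hw : w.Normalized) {μ : NCPoly B →ₗ[ℂ] B}
    (hμ : ∀ n, Continuous fun b => μ (word n b)) (n : ℕ) :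
    Continuous fun b => cumulant w μ (word (n + 1) b) := by
  induction n using Nat.strong_induction_on with
  | _ n ih =>
    have h : Continuous fun b => higherTerms w (cumulant w μ) (n + 1) b :=
      SeqContinuous.continuous fun b c hb =>
        tendsto_higherTerms w (fun m hm => strongTendsto_const_iff.mpr (ih m hm)) hb
    refine ((hμ (n + 1)).sub h).congr fun b => ?_
    rw [Pi.sub_apply, word_eq_cumulant_add hw μ, add_sub_cancel_right]

/-- Terms with at least two blocks are negligible in the limit of rare events. -/
theorem tendsto_smul_higherTerms (w : Weight) {k : ℕ → ℕ} (hk : Tendsto k atTop atTop)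
    {R : ℕ → NCPoly B →ₗ[ℂ] B} {L : NCPoly B →ₗ[ℂ] B} {n : ℕ}
    (h : ∀ m < n, StrongTendsto (m + 1) (fun i => (k i : ℂ) • R i) L) (b : ℕ → B) :
    Tendsto (fun i => (k i : ℂ) • higherTerms w (R i) (n + 1) b) atTop (𝓝 0) := by
  have hinv : Tendsto (fun i => ((k i : ℂ))⁻¹) atTop (𝓝 0) :=
    (tendsto_inv_atTop_nhds_zero_nat (𝕜 := ℂ)).comp hk
  have key : ∀ π ∈ Finset.univ.filter fun π : Finpartition (Finset.Icc 1 (n + 1)) =>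
      2 ≤ π.parts.card,
      Tendsto (fun i => (k i : ℂ) • w (n + 1) π • nest (R i) π.parts b) atTop (𝓝 0) := by
    intro π hπ
    have h2 := (Finset.mem_filter.mp hπ).2
    -- Write `k R_π` as `k^(-(|π|-1)) (kR)_π`. The second factor converges, and the exponent `|π| -
    -- 1` is positive, so the product tends to zero.
    have ht := ((hinv.pow (π.parts.card - 1)).smul
      (tendsto_nest h h2 (tendsto_const_nhds (x := b)))).const_smul (w (n + 1) π)
    rw [zero_pow (by omega), zero_smul, smul_zero] at ht
    refine ht.congr' ?_
    filter_upwards [hk.eventually_ge_atTop 1] with i hi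
    have hne : (k i : ℂ) ≠ 0 := by exact_mod_cast (by omega : k i ≠ 0)
    rw [nest_smul, smul_comm (k i : ℂ), smul_smul (_ ^ _)]
    congr 2
    obtain ⟨m, hm⟩ : ∃ m, π.parts.card = m + 1 := ⟨π.parts.card - 1, by omega⟩
    rw [hm, Nat.add_sub_cancel, pow_succ, ← mul_assoc, ← mul_pow, inv_mul_cancel₀ hne, one_pow,
      one_mul]
  have := tendsto_finsetSum _ key
  simpa only [higherTerms, Finset.smul_sum, Finset.sum_const_zero] using this

/-- The scaled moment and the scaled cumulant differ by `k` times the terms with at least two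
blocks, which vanish once the lower scaled cumulants converge strongly. From moments to cumulants
this needs induction on the degree; the converse is direct. -/
theorem tendsto_moments_iff {w : Weight} (hw : w.Normalized) {k : ℕ → ℕ}
    (hk : Tendsto k atTop atTop) {μ : ℕ → NCPoly B →ₗ[ℂ] B}
    (hμ : ∀ i, HasBoundedMoments (μ i)) {L : NCPoly B →ₗ[ℂ] B} :
    (∀ n b, Tendsto (fun i => (k i : ℂ) • μ i (word (n + 1) b)) atTop
      (𝓝 (L (word (n + 1) b)))) ↔
    ∀ n, StrongTendsto (n + 1) (fun i => (k i : ℂ) • cumulant w (μ i)) L := by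
  constructor
  · intro h n
    induction n using Nat.strong_induction_on with
    | _ n ih =>
      refine strongTendsto_of_tendsto (fun i => ?_) fun b => ?_
      · exact (continuous_cumulant hw (hμ i).continuous_word n).const_smul _
      · have := (h n b).sub (tendsto_smul_higherTerms w hk ih b)
        rw [sub_zero] at this
        refine this.congr fun i => ?_
        rw [word_eq_cumulant_add hw, smul_add, add_sub_cancel_right, LinearMap.smul_apply]
  · intro h n b
    have := ((h n).tendsto b).add (tendsto_smul_higherTerms w hk (n := n) (fun m _ => h m) b)
    rw [add_zero] at this
    refine this.congr fun i => ?_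
    rw [word_eq_cumulant_add hw (μ i), smul_add, LinearMap.smul_apply]

/-! ### From words to polynomials, and the equivalences -/

theorem convergesTo_iff_word {μ : ℕ → NCPoly B →ₗ[ℂ] B} {ν : NCPoly B →ₗ[ℂ] B} :
    ConvergesTo μ ν ↔
      ∀ n b, Tendsto (fun i => μ i (word n b)) atTop (𝓝 (ν (word n b))) := by
  refine ⟨fun h n b => h _, fun h P => ?_⟩
  have hP : P ∈ Submodule.span ℂ {P : NCPoly B | ∃ (n : ℕ) (b : ℕ → B), P = word n b} := by
    rw [span_word]
    trivial
  induction hP using Submodule.span_induction with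
  | mem P hP => obtain ⟨n, b, rfl⟩ := hP; exact h n b
  | zero => simp
  | add P Q _ _ hP hQ => simpa only [map_add] using hP.add hQ
  | smul c P _ hP => simpa only [map_smul] using hP.const_smul c

/-- Triangularity again, now without rescaling: the terms with at least two blocks converge to those
of `L` instead of vanishing, and are subtracted or added degree by degree. -/
theorem convergesTo_ofCumulants_iff {w : Weight} (hw : w.Normalized)
    {R : ℕ → NCPoly B →ₗ[ℂ] B} {L : NCPoly B →ₗ[ℂ] B}
    (hR : ∀ i n, Continuous fun b => R i (word (n + 1) b)) :
    ConvergesTo (fun i => ofCumulants w (R i)) (ofCumulants w L) ↔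
      ∀ n, StrongTendsto (n + 1) R L := by
  rw [convergesTo_iff_word]
  constructor
  · intro h n
    induction n using Nat.strong_induction_on with
    | _ n ih =>
      refine strongTendsto_of_tendsto (fun i => hR i n) fun b => ?_
      have := (h (n + 1) b).sub (tendsto_higherTerms w ih (tendsto_const_nhds (x := b)))
      simpa only [ofCumulants_word_succ hw, add_sub_cancel_right] using this
  · intro h n b
    cases n with
    | zero => simpa only [ofCumulants_word_zero hw] using tendsto_const_nhds
    | succ n =>
      simp only [ofCumulants_word_succ hw]
      exact ((h n).tendsto b).add
        (tendsto_higherTerms w (fun m _ => h m) (tendsto_const_nhds (x := b)))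

theorem convergesTo_convPow_iff {w : Weight} (hw : w.Normalized) {k : ℕ → ℕ}
    (hk : Tendsto k atTop atTop) {μ : ℕ → NCPoly B →ₗ[ℂ] B}
    (hμ : ∀ i, HasBoundedMoments (μ i)) {L : NCPoly B →ₗ[ℂ] B} :
    ConvergesTo (fun i => convPow w (k i) (μ i)) (ofCumulants w L) ↔
      ∀ n b, Tendsto (fun i => (k i : ℂ) • μ i (word (n + 1) b)) atTop
        (𝓝 (L (word (n + 1) b))) :=
  (convergesTo_ofCumulants_iff hw fun i n =>
    (continuous_cumulant hw (hμ i).continuous_word n).const_smul (k i : ℂ)).trans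
    (tendsto_moments_iff hw hk hμ).symm

theorem tendsto_levyCumulant_iff (k : ℕ → ℕ) {μ : ℕ → NCPoly B →ₗ[ℂ] B}
    (hμ : ∀ i, IsBimoduleMap (μ i)) (γ : B) (σ : NCPoly B →ₗ[ℂ] B) :
    (Tendsto (fun i => (k i : ℂ) • μ i X) atTop (𝓝 γ) ∧
      ∀ (n : ℕ) (b : ℕ → B),
        Tendsto (fun i => (k i : ℂ) • μ i (X * word n b * X)) atTop (𝓝 (σ (word n b)))) ↔
    ∀ n b, Tendsto (fun i => (k i : ℂ) • μ i (word (n + 1) b)) atTop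
      (𝓝 (levyCumulant γ σ (word (n + 1) b))) := by
  constructor
  · rintro ⟨h1, h2⟩ n b
    cases n with
    | zero =>
      rw [levyCumulant_word_one]
      refine ((h1.const_mul (b 0)).mul_const (b 1)).congr fun i => ?_
      rw [(hμ i).word_one, mul_smul_comm, smul_mul_assoc]
    | succ n =>
      rw [levyCumulant_word_add_two]
      refine (((h2 n _).const_mul (b 0)).mul_const (b (n + 2))).congr fun i => ?_
      rw [(hμ i).word_add_two, mul_smul_comm, smul_mul_assoc]
  · intro h
    refine ⟨?_, fun n b => ?_⟩
    · have := h 0 fun _ => 1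
      simpa only [zero_add, levyCumulant_word_one, (hμ _).word_one, one_mul, mul_one] using this
    -- Pad with `1` at both ends and shift by one: positions `1, …, n + 1` carry `b 0, …, b n`, so
    -- the word becomes `X * word n b * X`.
    · have := h (n + 1) fun j => if j = 0 then 1 else if j ≤ n + 1 then b (j - 1) else 1
      have hw : (word n fun j => if 1 + j = 0 then 1 else
          if 1 + j ≤ n + 1 then b (1 + j - 1) else 1) = word n b :=
        word_congr n fun j hj => by
          rw [if_neg (by omega), if_pos (by omega), Nat.add_sub_cancel_left]
      rw [levyCumulant_word_add_two, hw] at this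
      simp only [(hμ _).word_add_two, hw] at this
      simpa using this

end Analytic

end NCPoly

theorem mainTheorem1 {B : Type*} [CStarAlgebra B] (k : ℕ → ℕ) (hk : Tendsto k atTop atTop)
    (μ : ℕ → NCPoly B →ₗ[ℂ] B) (hμ : ∀ i, NCPoly.IsBimoduleMap (μ i))
    (hbdd : ∀ i, NCPoly.HasBoundedMoments (μ i))
    (γ : B) (σ : NCPoly B →ₗ[ℂ] B) :
    List.TFAE [
      Tendsto (fun i => (k i : ℂ) • μ i NCPoly.X) atTop (𝓝 γ) ∧
        ∀ (n : ℕ) (b : ℕ → B),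
          Tendsto (fun i => (k i : ℂ) • μ i (NCPoly.X * NCPoly.word n b * NCPoly.X)) atTop
            (𝓝 (σ (NCPoly.word n b))),
      NCPoly.ConvergesTo (fun i => NCPoly.freePow (k i) (μ i)) (NCPoly.freeLimit γ σ),
      NCPoly.ConvergesTo (fun i => NCPoly.booleanPow (k i) (μ i)) (NCPoly.booleanLimit γ σ),
      NCPoly.ConvergesTo (fun i => NCPoly.monotonePow (k i) (μ i)) (NCPoly.monotoneLimit γ σ)] := by
  have ha := NCPoly.tendsto_levyCumulant_iff k hμ γ σ
  tfae_have 1 ↔ 2 :=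
    ha.trans (NCPoly.convergesTo_convPow_iff NCPoly.normalized_freeWeight hk hbdd).symm
  tfae_have 1 ↔ 3 :=
    ha.trans (NCPoly.convergesTo_convPow_iff NCPoly.normalized_booleanWeight hk hbdd).symm
  tfae_have 1 ↔ 4 :=
    ha.trans (NCPoly.convergesTo_convPow_iff NCPoly.normalized_monotoneWeight hk hbdd).symm
  tfae_finish
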